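/- Let $R$ be an associative ring with unit which is right Noetherian, and let $\mathcal{D}(R)$ be the (unbounded) derived category of right $R$-modules. Let $S\in\mathcal{D}(R)$ be the complex with the right module $R$ in degree zero and zero elsewhere, let $\mathrm{thick}\langle S\rangle$ be the smallest class of objects of $\mathcal{D}(R)$ that contains $S$ and is closed under suspension and desuspension, retracts and cofiber sequences (if two of the three objects of a distinguished triangle are in the class, so is the third), and write $\pi_*(-)=\mathrm{Hom}^*_{\mathcal{D}(R)}(S,-)$, that is, $\pi_*$ is given by the functors $X\mapsto\mathrm{Hom}_{\mathcal{D}(R)}(S,X[n])$, $n\in\mathbb{Z}$. The generating hypothesis in $\mathcal{D}(R)$ is the statement: every morphism $f\colon X\to Y$ with $X,Y\in\mathrm{thick}\langle S\rangle$ and $\pi_*f=0$ is zero. Then the generating hypothesis is true in $\mathcal{D}(R)$ if and only if $R$ is semisimple, i.e. $R$, as a right module over itself, is a finite direct sum of simple modules. If $R$ is moreover commutative, then the generating hypothesis is true in $\mathcal{D}(R)$ if and only if $R$ is isomorphic to a finite (possibly empty) product of fields. -/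

import Mathlib

open CategoryTheory Limits Pretriangulated

universe w v u

/-- Objects of the thick subcategory generated by `S`: the smallest class of objects which contains
`S` and is closed under (de)suspension, retracts and cofiber sequences (two out of three in
distinguished triangles). -/
def thickSubcategory {D : Type u} [Category.{v} D] [HasZeroObject D] [HasShift D ℤ] [Preadditive D]
    [∀ n : ℤ, (shiftFunctor D n).Additive] [Pretriangulated D] (S : D) : ObjectProperty D :=
  fun X => ∀ P : ObjectProperty D, P.IsTriangulated → P.IsStableUnderRetracts → P S → P X

/-- The thick subcategory generated by `S` agrees with Mathlib's explicit triangulated envelope. -/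
theorem thickSubcategory_eq_triangEnvelope {D : Type u} [Category.{v} D] [HasZeroObject D]
    [HasShift D ℤ] [Preadditive D] [∀ n : ℤ, (shiftFunctor D n).Additive] [Pretriangulated D]
    [IsTriangulated D] (S : D) :
    thickSubcategory S = (ObjectProperty.singleton S).triangEnvelope := by
  apply le_antisymm
  · intro X hX
    exact hX _ inferInstance inferInstance
      (ObjectProperty.le_triangEnvelope _ _ (by simp))
  · intro X hX P hP hP' hS
    exact (ObjectProperty.triangEnvelope_le_iff _ (Q := P)).2 (by simpa using hS) _ hX

/-- `π_* f = 0`, where `π_* = Hom^*(S, -)`, i.e. `π_*` is in degree `n` the functor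
`X ↦ Hom(S, X⟦n⟧)`. -/
def HomotopyTrivial {D : Type u} [Category.{v} D] [HasShift D ℤ] [Preadditive D] (S : D)
    {X Y : D} (f : X ⟶ Y) : Prop :=
  ∀ (n : ℤ) (a : S ⟶ (shiftFunctor D n).obj X), a ≫ (shiftFunctor D n).map f = 0

/-- The generating hypothesis for a triangulated category with a distinguished object `S`. -/
def GeneratingHypothesis {D : Type u} [Category.{v} D] [HasZeroObject D] [HasShift D ℤ]
    [Preadditive D] [∀ n : ℤ, (shiftFunctor D n).Additive] [Pretriangulated D] (S : D) : Prop :=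
  ∀ ⦃X Y : D⦄ (f : X ⟶ Y), thickSubcategory S X → thickSubcategory S Y →
    HomotopyTrivial S f → f = 0

/-- The sphere object of the derived category of right `R`-modules: the complex with the right
regular module `R` in degree zero and zero elsewhere. -/
noncomputable def sphere (R : Type u) [Ring R] [HasDerivedCategory.{w} (ModuleCat.{u} Rᵐᵒᵖ)] :
    DerivedCategory (ModuleCat.{u} Rᵐᵒᵖ) :=
  (DerivedCategory.singleFunctor (ModuleCat.{u} Rᵐᵒᵖ) 0).obj (ModuleCat.of Rᵐᵒᵖ R)

/-- `R` is isomorphic, as a ring, to a finite (possibly empty) product of fields. -/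
def IsFiniteProductOfFields (R : Type u) [Ring R] : Prop :=
  ∃ (n : ℕ) (K : Fin n → Type u) (_ : ∀ i, Field (K i)), Nonempty (R ≃+* (∀ i, K i))

/-! Call a map ghost if `π_*` kills it. If `R` is semisimple, all linear maps are von Neumann
regular, so a chain map sending cycles to boundaries has an explicit null-homotopy. Hence every
ghost vanishes, even outside the thick subcategory.

Conversely, let `I` be a right ideal. The Noetherian hypothesis gives an exact `R^l → R^k → R` (maps
`b`, `a`) with `a` of image `I`. Let `X` be the cone of `a`. The maps `R → X` and `R^l[1] → X` (a
lift of `b[1]`) are jointly onto on `π_*`, so the next map in their cofiber sequence is a ghost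
between thick objects. It vanishes, and the joint map splits. The component `R → X → R` of the
splitting kills `I` and is the identity modulo `I`, so `I` is a summand. The work is in
`DerivedCategory.exists_retraction_of_generatingHypothesis`. -/

/-- The sphere can be tested against the single complexes in all degrees. -/
theorem homotopyTrivial_single_iff {C : Type u} [Category.{v} C] [Abelian C]
    [HasDerivedCategory.{w} C] (M : C) {X Y : DerivedCategory C} (f : X ⟶ Y) :
    HomotopyTrivial ((DerivedCategory.singleFunctor C 0).obj M) f ↔
      ∀ (n : ℤ) (a : (DerivedCategory.singleFunctor C n).obj M ⟶ X), a ≫ f = 0 := by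
  constructor
  · intro h n a
    let e := ((DerivedCategory.singleFunctors C).shiftIso n 0 n (by simp)).app M
    have := h n (e.inv ≫ (shiftFunctor _ n).map a)
    rw [Category.assoc, ← Functor.map_comp, Preadditive.IsIso.comp_left_eq_zero] at this
    exact (shiftFunctor (DerivedCategory C) n).map_injective (by rw [this, Functor.map_zero])
  · intro h n a
    let e := ((DerivedCategory.singleFunctors C).shiftIso n 0 n (by simp)).app M
    obtain ⟨b, hb⟩ := (shiftFunctor (DerivedCategory C) n).map_surjective (e.hom ≫ a)
    rw [← Preadditive.IsIso.comp_left_eq_zero e.hom, ← Category.assoc, ← hb, ← Functor.map_comp,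
      h n b, Functor.map_zero]

/-! ### Semisimple rings: ghosts vanish -/

/-- Linear maps over a semisimple ring are von Neumann regular. -/
theorem LinearMap.exists_comp_comp_eq_self {A M N : Type*} [Ring A] [IsSemisimpleRing A]
    [AddCommGroup M] [Module A M] [AddCommGroup N] [Module A N] (d : M →ₗ[A] N) :
    ∃ u : N →ₗ[A] M, d ∘ₗ u ∘ₗ d = d := by
  obtain ⟨s, hs⟩ := IsSemisimpleModule.lifting_property d.rangeRestrict d.surjective_rangeRestrict
    LinearMap.id
  obtain ⟨u, hu⟩ := IsSemisimpleModule.extension_property (LinearMap.range d).subtype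
    Subtype.val_injective s
  refine ⟨u, LinearMap.ext fun x => ?_⟩
  have h₁ := LinearMap.congr_fun hu (d.rangeRestrict x)
  have h₂ := congrArg Subtype.val (LinearMap.congr_fun hs (d.rangeRestrict x))
  change u (d x) = s (d.rangeRestrict x) at h₁
  change d (s (d.rangeRestrict x)) = d x at h₂
  change d (u (d x)) = d x
  rw [h₁, h₂]

/-- Over a semisimple ring, a chain map which sends cycles to boundaries is null-homotopic. -/
theorem nonempty_homotopy_zero_of_isSemisimpleRing {A : Type u} [Ring A] [IsSemisimpleRing A]
    {K L : CochainComplex (ModuleCat.{v} A) ℤ} (g : K ⟶ L)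
    (hg : ∀ (i j k : ℤ), i + 1 = j → j + 1 = k → ∀ x : K.X j, K.d j k x = 0 →
      ∃ y : L.X i, L.d i j y = g.f j x) :
    Nonempty (Homotopy g 0) := by
  have hu : ∀ (K : CochainComplex (ModuleCat.{v} A) ℤ) (i j : ℤ),
      ∃ u : K.X i ⟶ K.X j, K.d j i ≫ u ≫ K.d j i = K.d j i := fun K i j => by
    obtain ⟨u, hu⟩ := (K.d j i).hom.exists_comp_comp_eq_self
    exact ⟨ModuleCat.ofHom u, ModuleCat.hom_ext hu⟩
  choose uK huK using hu K
  choose uL huL using hu L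
  -- `𝟙 - d ≫ u` projects onto cycles, which `g` sends to boundaries, and `uL` lifts those. The
  -- factor `𝟙 - u ≫ d` kills boundaries, so the second summand drops out of `d ≫ h`.
  let h : ∀ i j : ℤ, K.X i ⟶ L.X j := fun i j =>
    if j + 1 = i then uK i j ≫ g.f j + (𝟙 _ - uK i j ≫ K.d j i) ≫
      (𝟙 _ - K.d i (i + 1) ≫ uK (i + 1) i) ≫ g.f i ≫ uL i j else 0
  have hcycle : ∀ i j k : ℤ, i + 1 = j → j + 1 = k →
      (𝟙 _ - K.d j k ≫ uK k j) ≫ g.f j ≫ uL j i ≫ L.d i j =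
        (𝟙 _ - K.d j k ≫ uK k j) ≫ g.f j := by
    intro i j k hij hjk
    ext x
    have hx : K.d j k ((𝟙 (K.X j) - K.d j k ≫ uK k j) x) = 0 := by
      rw [← ModuleCat.comp_apply]
      simp only [Preadditive.sub_comp, Category.id_comp, Category.assoc, huK, sub_self]
      rfl
    obtain ⟨y, hy⟩ := hg i j k hij hjk _ hx
    simp only [ModuleCat.comp_apply]
    rw [← hy]
    exact ConcreteCategory.congr_hom (huL j i) y
  refine ⟨{ hom := h, zero := fun i j hij => if_neg hij, comm := fun j => ?_ }⟩
  obtain ⟨i, hij⟩ : ∃ i : ℤ, i + 1 = j := ⟨j - 1, by lia⟩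
  rw [dNext_eq h (show (ComplexShape.up ℤ).Rel j (j + 1) from rfl),
    prevD_eq h (show (ComplexShape.up ℤ).Rel i j from hij)]
  have h₁ : K.d j (j + 1) ≫ h (j + 1) j = K.d j (j + 1) ≫ uK (j + 1) j ≫ g.f j := by
    have : K.d j (j + 1) ≫ (𝟙 _ - uK (j + 1) j ≫ K.d j (j + 1)) = 0 := by
      simp [Preadditive.comp_sub, huK]
    simp only [h, if_true, Preadditive.comp_add, reassoc_of% this, zero_comp, add_zero]
  have h₂ : h j i ≫ L.d i j = g.f j - K.d j (j + 1) ≫ uK (j + 1) j ≫ g.f j := by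
    simp only [h, if_pos hij, Preadditive.add_comp, Category.assoc, hcycle i j _ hij rfl,
      HomologicalComplex.Hom.comm]
    simp only [Preadditive.sub_comp, Category.id_comp, Category.assoc, Preadditive.comp_sub,
      HomologicalComplex.d_comp_d_assoc, zero_comp, comp_zero, sub_zero]
    abel
  rw [h₁, h₂]
  simp

/-- Since `ψ` vanishes on homology, its component is a boundary after pullback along some
epimorphism onto the source; projectivity of `P` gives a section of that epimorphism. -/
theorem exists_comp_d_eq_of_Q_map_eq_zero {C : Type u} [Category.{v} C] [Abelian C]
    [HasDerivedCategory.{w} C] {P : C} [Projective P] {L : CochainComplex C ℤ} {i j : ℤ}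
    (hij : i + 1 = j) (ψ : (HomologicalComplex.single C (ComplexShape.up ℤ) j).obj P ⟶ L)
    (hψ : DerivedCategory.Q.map ψ = 0) :
    ∃ x : P ⟶ L.X i, x ≫ L.d i j =
      (HomologicalComplex.singleObjXSelf (ComplexShape.up ℤ) j P).inv ≫ ψ.f j := by
  have h0 : HomologicalComplex.homologyMap ψ j = 0 := by
    have := NatIso.naturality_1 (DerivedCategory.homologyFunctorFactors C j) ψ
    rw [Functor.comp_map, hψ, Functor.map_zero, zero_comp, comp_zero] at this
    exact this.symm
  have hk : ψ.f j ≫ L.d j (j + 1) = 0 := by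
    rw [ψ.comm]
    simp
  have h1 : L.liftCycles (ψ.f j) (j + 1) (by simp) hk ≫ L.homologyπ j = 0 := by
    have : L.liftCycles (ψ.f j) (j + 1) (by simp) hk =
      HomologicalComplex.liftCycles _ (𝟙 _) (j + 1) (by simp) (by simp) ≫
        HomologicalComplex.cyclesMap ψ j := by
      rw [← cancel_mono (L.iCycles j)]
      simp
    rw [this, Category.assoc, ← HomologicalComplex.homologyπ_naturality, h0]
    simp
  rw [HomologicalComplex.liftCycles_comp_homologyπ_eq_zero_iff_up_to_refinements _ i _ _
    (by simp; lia)] at h1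
  obtain ⟨A, π, hπ, y, hy⟩ := h1
  let e := (HomologicalComplex.singleObjXSelf (ComplexShape.up ℤ) j P)
  refine ⟨Projective.factorThru e.inv π ≫ y, ?_⟩
  rw [Category.assoc, ← hy, Projective.factorThru_comp_assoc]

/-- Over a semisimple ring every ghost in the unbounded derived category vanishes. -/
theorem eq_zero_of_homotopyTrivial_of_isSemisimpleRing {A : Type u} [Ring A] [IsSemisimpleRing A]
    [HasDerivedCategory.{w} (ModuleCat.{u} A)] (M : ModuleCat.{u} A) (E : A ≃ₗ[A] M)
    {X Y : DerivedCategory (ModuleCat.{u} A)} (f : X ⟶ Y)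
    (hf : HomotopyTrivial ((DerivedCategory.singleFunctor (ModuleCat.{u} A) 0).obj M) f) :
    f = 0 := by
  rw [homotopyTrivial_single_iff] at hf
  let eX := DerivedCategory.Q.objObjPreimageIso X
  let eY := DerivedCategory.Q.objObjPreimageIso Y
  obtain ⟨L, g, s, hs, hfac⟩ := DerivedCategory.left_fac (eX.hom ≫ f ≫ eY.inv)
  have : Projective M := (IsProjective.iff_projective _).1
    (Module.Projective.of_equiv E)
  suffices Nonempty (Homotopy g 0) by
    obtain ⟨H⟩ := this
    rw [DerivedCategory.Q_map_eq_of_homotopy _ H, Functor.map_zero, zero_comp,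
      Preadditive.IsIso.comp_left_eq_zero, Preadditive.IsIso.comp_right_eq_zero] at hfac
    exact hfac
  apply nonempty_homotopy_zero_of_isSemisimpleRing
  -- A cycle `x` is a map from the sphere, carrying the generator `E 1` to `x`.
  intro i j k hij hjk x hx
  let φ : M ⟶ (DerivedCategory.Q.objPreimage X).X j :=
    ModuleCat.ofHom ((LinearMap.toSpanSingleton A _ x) ∘ₗ E.symm.toLinearMap)
  have hφ : ∀ l, (ComplexShape.up ℤ).Rel j l → φ ≫ (DerivedCategory.Q.objPreimage X).d j l = 0 := by
    intro l hl
    obtain rfl : k = l := hjk.symm.trans hl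
    ext m
    simp [φ, hx]
  let ψ := HomologicalComplex.mkHomFromSingle φ hφ
  obtain ⟨y, hy⟩ := exists_comp_d_eq_of_Q_map_eq_zero hij (ψ ≫ g) (by
    have h : DerivedCategory.Q.map ψ ≫ eX.hom ≫ f = 0 :=
      (Category.assoc _ _ _).symm.trans (hf j (DerivedCategory.Q.map ψ ≫ eX.hom))
    rw [← Preadditive.IsIso.comp_right_eq_zero _ (inv (DerivedCategory.Q.map s)),
      DerivedCategory.Q.map_comp, Category.assoc, ← hfac]
    rw [reassoc_of% h, zero_comp])
  refine ⟨y (E 1), ?_⟩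
  have := ConcreteCategory.congr_hom hy (E 1)
  rw [ModuleCat.comp_apply] at this
  rw [this]
  simp [ψ, HomologicalComplex.mkHomFromSingle_f, φ]

/-! ### The generating hypothesis splits ideals -/

namespace DerivedCategory

variable {C : Type u} [Category.{v} C] [Abelian C] [HasDerivedCategory.{w} C]

/-- Negative Ext groups vanish always, positive ones because `P` is projective. -/
theorem hom_singleFunctor_eq_zero_of_ne {P N : C} [Projective P] {a b : ℤ} (hab : a ≠ b)
    (f : (singleFunctor C a).obj P ⟶ (singleFunctor C b).obj N) : f = 0 := by
  rcases lt_or_gt_of_ne hab with h | h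
  · exact (subsingleton_hom_of_isStrictlyLE_of_isStrictlyGE
      ((CochainComplex.singleFunctor C a).obj P) ((CochainComplex.singleFunctor C b).obj N)
      a b h).elim f 0
  · exact from_singleFunctor_obj_eq_zero_of_projective
      (L := (CochainComplex.singleFunctor C b).obj N) f b h

theorem hom_singleFunctor_shift_eq_zero_of_ne {P N : C} [Projective P] {a : ℤ} (ha : a ≠ -1)
    (f : (singleFunctor C a).obj P ⟶ ((singleFunctor C 0).obj N)⟦(1 : ℤ)⟧) : f = 0 := by
  rw [← Preadditive.IsIso.comp_right_eq_zero _
    (((singleFunctors C).shiftIso 1 (-1) 0 (by simp)).app N).hom]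
  exact hom_singleFunctor_eq_zero_of_ne ha _

/-- A three-term complex of finite objects which is exact in the middle, as tested by `M`,
has a split image in the last term if the generating hypothesis holds. -/
theorem exists_retraction_of_generatingHypothesis {M P₀ P₁ P₂ : C} [Projective M] [Projective P₀]
    (h : GeneratingHypothesis ((singleFunctor C 0).obj M))
    (h₀ : thickSubcategory ((singleFunctor C 0).obj M) ((singleFunctor C 0).obj P₀))
    (h₁ : thickSubcategory ((singleFunctor C 0).obj M) ((singleFunctor C 0).obj P₁))
    (h₂ : thickSubcategory ((singleFunctor C 0).obj M) ((singleFunctor C 0).obj P₂))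
    (b : P₂ ⟶ P₁) (a : P₁ ⟶ P₀) (hba : b ≫ a = 0)
    (hex : ∀ β : M ⟶ P₁, β ≫ a = 0 → ∃ γ : M ⟶ P₂, β = γ ≫ b) :
    ∃ (ρ : P₀ ⟶ P₀) (q : P₀ ⟶ P₁), a ≫ ρ = 0 ∧ ρ = 𝟙 _ + q ≫ a := by
  let F := singleFunctor C 0
  obtain ⟨T, _, _, hthick⟩ : ∃ T : ObjectProperty (DerivedCategory C), T.IsTriangulated ∧
      T.IsClosedUnderIsomorphisms ∧ thickSubcategory (F.obj M) = T :=
    ⟨_, inferInstance, inferInstance, thickSubcategory_eq_triangEnvelope _⟩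
  rw [hthick] at h₀ h₁ h₂
  obtain ⟨X, i, δ, hT⟩ := distinguished_cocone_triangle (F.map a)
  have hX : T X := T.ext_of_isTriangulatedClosed₃ _ hT h₁ h₀
  have ex₂ : ∀ {A} (f : A ⟶ F.obj P₀), f ≫ i = 0 → ∃ g : A ⟶ F.obj P₁, f = g ≫ F.map a :=
    fun f hf => Triangle.coyoneda_exact₂ _ hT f hf
  have ex₃ : ∀ {A} (f : A ⟶ X), f ≫ δ = 0 → ∃ g : A ⟶ F.obj P₀, f = g ≫ i :=
    fun f hf => Triangle.coyoneda_exact₃ _ hT f hf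
  have hba' : (F.map b)⟦(1 : ℤ)⟧' ≫ (F.map a)⟦(1 : ℤ)⟧' = 0 := by
    rw [← Functor.map_comp, ← F.map_comp, hba, F.map_zero, Functor.map_zero]
  obtain ⟨c, hc⟩ : ∃ c : (F.obj P₂)⟦(1 : ℤ)⟧ ⟶ X, (F.map b)⟦(1 : ℤ)⟧' = c ≫ δ :=
    Triangle.coyoneda_exact₁ _ hT ((F.map b)⟦(1 : ℤ)⟧') hba'
  have hW : T (F.obj P₀ ⊞ (F.obj P₂)⟦(1 : ℤ)⟧) :=
    T.ext_of_isTriangulatedClosed₂ _ (binaryBiproductTriangle_distinguished _ _) h₀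
      (T.le_shift (1 : ℤ) _ h₂)
  obtain ⟨Z, w, δ', hT'⟩ := distinguished_cocone_triangle (biprod.desc i c)
  have hZ : T Z := T.ext_of_isTriangulatedClosed₃ _ hT' hW hX
  have hw₀ : biprod.desc i c ≫ w = 0 := comp_distTriang_mor_zero₁₂ _ hT'
  have hiw : i ≫ w = 0 := by rw [← biprod.inl_desc i c, Category.assoc, hw₀, comp_zero]
  have hcw : c ≫ w = 0 := by rw [← biprod.inr_desc i c, Category.assoc, hw₀, comp_zero]
  have hw : w = 0 := by
    refine h w (by rwa [hthick]) (by rwa [hthick])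
      ((homotopyTrivial_single_iff M w).2 fun n α => ?_)
    -- Only in degree `-1` can `α ≫ δ` be nonzero. There it comes from a map killed by `a`, hence
    -- factoring through `b`; subtracting the matching multiple of `c` leaves a map through `P₀`,
    -- zero for degree reasons.
    by_cases hn : n = -1
    · subst hn
      let e := ((singleFunctors C).shiftIso 1 (-1) 0 (by simp)).app M
      obtain ⟨β, hβ⟩ := ((shiftFunctor (DerivedCategory C) (1 : ℤ)).map_surjective
        (e.hom ≫ α ≫ δ))
      obtain ⟨β, rfl⟩ := F.map_surjective β
      have hβa : β ≫ a = 0 := by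
        apply F.map_injective
        apply (shiftFunctor (DerivedCategory C) (1 : ℤ)).map_injective
        rw [F.map_comp, Functor.map_comp, hβ, F.map_zero, Functor.map_zero, Category.assoc,
          Category.assoc]
        have : δ ≫ (F.map a)⟦(1 : ℤ)⟧' = 0 := comp_distTriang_mor_zero₃₁ _ hT
        rw [this, comp_zero, comp_zero]
      obtain ⟨γ, rfl⟩ := hex β hβa
      obtain ⟨α', hα'⟩ := ex₃ (α - e.inv ≫ (F.map γ)⟦(1 : ℤ)⟧' ≫ c) (by
        rw [Preadditive.sub_comp, Category.assoc, Category.assoc, ← hc, ← Functor.map_comp,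
          ← F.map_comp, hβ, Iso.inv_hom_id_assoc, sub_self])
      rw [hom_singleFunctor_eq_zero_of_ne (by simp) α', zero_comp, sub_eq_zero] at hα'
      rw [hα', Category.assoc, Category.assoc, hcw, comp_zero, comp_zero]
    · obtain ⟨α', rfl⟩ := ex₃ α (hom_singleFunctor_shift_eq_zero_of_ne hn _)
      rw [Category.assoc, hiw, comp_zero]
  obtain ⟨s, hs⟩ : ∃ s : X ⟶ F.obj P₀ ⊞ (F.obj P₂)⟦(1 : ℤ)⟧, 𝟙 X = s ≫ biprod.desc i c :=
    Triangle.coyoneda_exact₂ _ hT' (𝟙 X) ((Category.id_comp w).trans hw)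
  -- The `P₂` component of `i ≫ s` is a map `P₀ → P₂[1]`, hence zero.
  have hi : i = (i ≫ s ≫ biprod.fst) ≫ i := by
    have h₃ : s ≫ biprod.desc i c = (s ≫ biprod.fst) ≫ i + (s ≫ biprod.snd) ≫ c := by
      rw [biprod.desc_eq, Preadditive.comp_add, Category.assoc, Category.assoc]
    have h₄ : i ≫ s ≫ biprod.snd = 0 := hom_singleFunctor_shift_eq_zero_of_ne (by simp) _
    calc i = i ≫ s ≫ biprod.desc i c := by rw [← hs]; exact (Category.comp_id i).symm
      _ = _ := by
        rw [h₃, Preadditive.comp_add, ← Category.assoc i (s ≫ biprod.snd) c, h₄, zero_comp,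
          add_zero, Category.assoc, Category.assoc, Category.assoc]
  obtain ⟨ρ, hρ⟩ := F.map_surjective (i ≫ s ≫ biprod.fst)
  obtain ⟨q, hq⟩ := ex₂ (F.map ρ - 𝟙 _)
    (by rw [Preadditive.sub_comp, hρ, ← hi, Category.id_comp, sub_self])
  obtain ⟨q, rfl⟩ := F.map_surjective q
  refine ⟨ρ, q, F.map_injective ?_, F.map_injective ?_⟩
  · have : F.map a ≫ i = 0 := comp_distTriang_mor_zero₁₂ _ hT
    rw [F.map_comp, hρ, reassoc_of% this, zero_comp, F.map_zero]
  · rw [F.map_add, F.map_id, F.map_comp]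
    exact eq_add_of_sub_eq' hq

end DerivedCategory

theorem thickSubcategory_singleFunctor_pi {A : Type u} [Ring A]
    [HasDerivedCategory.{w} (ModuleCat.{u} A)] (M : ModuleCat.{u} A) (k : ℕ) :
    thickSubcategory ((DerivedCategory.singleFunctor (ModuleCat.{u} A) 0).obj M)
      ((DerivedCategory.singleFunctor (ModuleCat.{u} A) 0).obj
        (ModuleCat.of A (Fin k → M))) := by
  intro P _ _ hM
  exact P.prop_of_isLimit (isLimitOfPreserves (DerivedCategory.singleFunctor (ModuleCat.{u} A) 0)
    (ModuleCat.HasLimit.productLimitCone (fun _ : Fin k => M)).isLimit) (fun _ => hM)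

/-- `M` stands for the right module `R`, isomorphic but not equal to the regular module of `Rᵐᵒᵖ`.
-/
theorem isSemisimpleRing_of_generatingHypothesis {A : Type u} [Ring A] [IsNoetherianRing A]
    [HasDerivedCategory.{w} (ModuleCat.{u} A)] (M : ModuleCat.{u} A) (E : A ≃ₗ[A] M)
    (h : GeneratingHypothesis ((DerivedCategory.singleFunctor (ModuleCat.{u} A) 0).obj M)) :
    IsSemisimpleModule A M := by
  have hM : Module.Projective A M := Module.Projective.of_equiv E
  have hPM : Projective M := (IsProjective.iff_projective _).1 hM
  have hN : IsNoetherian A M := isNoetherian_of_linearEquiv E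
  have key : ∀ {N : Type u} [AddCommGroup N] [Module A N] (K : Submodule A N) [IsNoetherian A N],
      ∃ (k : ℕ) (p : (Fin k → M) →ₗ[A] N), LinearMap.range p = K := by
    intro N _ _ K _
    obtain ⟨k, p, hp⟩ := Module.Finite.exists_fin' A K
    refine ⟨k, K.subtype ∘ₗ (p ∘ₗ (LinearEquiv.piCongrRight fun _ => E.symm).toLinearMap), ?_⟩
    rw [LinearMap.range_comp, LinearEquiv.range_comp, LinearMap.range_eq_top.2 hp,
      Submodule.map_top, Submodule.range_subtype]
  refine { exists_isCompl := fun I => ?_ }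
  obtain ⟨k, p, hp⟩ := key I
  obtain ⟨l, p', hp'⟩ := key (LinearMap.ker p)
  obtain ⟨ρ, q, hρ, hq⟩ := DerivedCategory.exists_retraction_of_generatingHypothesis h
    (fun P _ _ hP => hP) (thickSubcategory_singleFunctor_pi M k)
    (thickSubcategory_singleFunctor_pi M l) (ModuleCat.ofHom p')
    (ModuleCat.ofHom (Y := M) p)
    (ModuleCat.hom_ext (LinearMap.range_le_ker_iff.1 hp'.le))
    (fun β hβ => by
      have hβ' : ∀ x, β.hom x ∈ LinearMap.ker p := fun x => LinearMap.congr_fun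
        (congrArg ModuleCat.Hom.hom hβ) x
      obtain ⟨γ, hγ⟩ := Module.projective_lifting_property p'.rangeRestrict
        (β.hom.codRestrict (LinearMap.range p') (fun x => hp' ▸ hβ' x))
        p'.surjective_rangeRestrict
      refine ⟨ModuleCat.ofHom γ, ModuleCat.hom_ext (LinearMap.ext fun x => ?_)⟩
      exact (congrArg Subtype.val (LinearMap.congr_fun hγ x)).symm)
  have hρI : ∀ x ∈ I, ρ.hom x = 0 := by
    intro x hx
    rw [← hp] at hx
    obtain ⟨y, rfl⟩ := hx
    exact LinearMap.congr_fun (congrArg ModuleCat.Hom.hom hρ) y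
  have hqx : ∀ x, ρ.hom x = x + p (q.hom x) := fun x =>
    LinearMap.congr_fun (congrArg ModuleCat.Hom.hom hq) x
  have hpI : ∀ y, p y ∈ I := fun y => hp ▸ LinearMap.mem_range_self p y
  -- `id - ρ` equals `-(p ∘ q)`, so it lands in `I`; it fixes `I` because `ρ` kills `I`.
  let π : M →ₗ[A] I := (LinearMap.id - ρ.hom).codRestrict I (fun x => by
    simpa [hqx] using hpI _)
  exact ⟨_, LinearMap.isCompl_of_proj (f := π) fun x => Subtype.ext (by simp [π, hρI x x.2])⟩

/-! ### Passage to the opposite ring and the commutative case -/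

/-- The right regular module is free of rank one over the opposite ring. -/
def MulOpposite.rightRegularLinearEquiv (R : Type u) [Ring R] : Rᵐᵒᵖ ≃ₗ[Rᵐᵒᵖ] R :=
  { MulOpposite.opAddEquiv.symm with map_smul' := fun _ _ => rfl }

theorem isSemisimpleModule_mulOpposite_iff (R : Type u) [Ring R] :
    IsSemisimpleModule Rᵐᵒᵖ R ↔ IsSemisimpleRing R :=
  (MulOpposite.rightRegularLinearEquiv R).isSemisimpleModule_iff.symm.trans
    isSemisimpleRing_mulOpposite_iff

/-- A commutative semisimple ring is Artinian and reduced, hence the product of its residue fields.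
-/
theorem isSemisimpleRing_iff_isFiniteProductOfFields {R : Type u} [Ring R]
    (hcomm : ∀ x y : R, x * y = y * x) :
    IsSemisimpleRing R ↔ IsFiniteProductOfFields R := by
  constructor
  · intro h
    let _ : CommRing R := { ‹Ring R› with mul_comm := hcomm }
    have : IsArtinianRing R := inferInstance
    have : IsReduced R := inferInstance
    let e := (Finite.equivFin (MaximalSpectrum R)).symm
    exact ⟨Nat.card (MaximalSpectrum R), fun i => R ⧸ (e i).asIdeal,
      fun i => Ideal.Quotient.field (e i).asIdeal,
      ⟨(IsArtinianRing.equivPi R).toRingEquiv.trans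
        (RingEquiv.piCongrLeft (fun I : MaximalSpectrum R => R ⧸ I.asIdeal) e).symm⟩⟩
  · rintro ⟨n, K, _, ⟨e⟩⟩
    exact e.symm.isSemisimpleRing

theorem mainTheorem3 (R : Type u) [Ring R] [HasDerivedCategory.{w} (ModuleCat.{u} Rᵐᵒᵖ)]
    (hR : IsNoetherian Rᵐᵒᵖ R) :
    (GeneratingHypothesis (sphere.{w} R) ↔ IsSemisimpleModule Rᵐᵒᵖ R) ∧
      ((∀ x y : R, x * y = y * x) →
        (GeneratingHypothesis (sphere.{w} R) ↔ IsFiniteProductOfFields R)) := by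
  have E := MulOpposite.rightRegularLinearEquiv R
  have main : GeneratingHypothesis (sphere.{w} R) ↔ IsSemisimpleModule Rᵐᵒᵖ R := by
    constructor
    · intro h
      have : IsNoetherianRing Rᵐᵒᵖ := isNoetherian_of_linearEquiv E.symm
      exact isSemisimpleRing_of_generatingHypothesis (ModuleCat.of Rᵐᵒᵖ R) E h
    · intro h X Y f _ _ hf
      have : IsSemisimpleRing Rᵐᵒᵖ := E.isSemisimpleModule_iff.2 h
      exact eq_zero_of_homotopyTrivial_of_isSemisimpleRing (ModuleCat.of Rᵐᵒᵖ R) E f hf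
  exact ⟨main, fun hcomm => main.trans ((isSemisimpleModule_mulOpposite_iff R).trans
    (isSemisimpleRing_iff_isFiniteProductOfFields hcomm))⟩
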